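/- Let $V$ be a complex vector space of dimension $2$ and let $n \geq 2$ be an integer. Let $S^nV$ be the $n$-th symmetric power of $V$, let $\mathrm{PGL}(V) = \mathrm{GL}(V)/\mathbb{C}^*$, and let $\mathrm{Grass}_2(S^nV \oplus S^nV)$ be the Grassmannian of $2$-dimensional linear subspaces of $S^nV \oplus S^nV$, on which $\mathrm{PGL}(V)$ acts by $[g] \cdot U = (S^ng \oplus S^ng)(U)$. This action is almost free: there is a dense Zariski open subset $X^0 \subseteq \mathrm{Grass}_2(S^nV \oplus S^nV)$ such that the stabiliser of each closed point $U \in X^0$ in $\mathrm{PGL}(V)$ is trivial. -/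

import Mathlib

open Module

noncomputable section

namespace InstantonGrass

section SymmetricPowers

variable (K : Type*) [Field K] (V : Type*) [AddCommGroup V] [Module K V]

/-- The `n`-th symmetric power `S^n V`, realised as the degree `n` part of the symmetric algebra
of `V`, i.e. the linear span of all products `v₁ ⋯ vₙ` of `n` vectors of `V`. -/
abbrev SymPow (n : ℕ) : Type _ :=
  ↥((LinearMap.range (SymmetricAlgebra.ι K V)) ^ n : Submodule K (SymmetricAlgebra K V))

variable {K V}

/-- The algebra endomorphism of the symmetric algebra induced by a linear endomorphism of `V`:
`v₁ ⋯ vₙ ↦ f v₁ ⋯ f vₙ`. -/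
def symAlgMap (f : V →ₗ[K] V) : SymmetricAlgebra K V →ₐ[K] SymmetricAlgebra K V :=
  SymmetricAlgebra.lift (SymmetricAlgebra.ι K V ∘ₗ f)

@[simp] lemma symAlgMap_ι (f : V →ₗ[K] V) (v : V) :
    symAlgMap f (SymmetricAlgebra.ι K V v) = SymmetricAlgebra.ι K V (f v) := by
  simp [symAlgMap]

lemma symAlgMap_one : symAlgMap (1 : V →ₗ[K] V) = AlgHom.id K _ := by
  apply SymmetricAlgebra.algHom_ext
  ext v
  simp

lemma symAlgMap_mul (f g : V →ₗ[K] V) :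
    symAlgMap (f * g) = (symAlgMap f).comp (symAlgMap g) := by
  apply SymmetricAlgebra.algHom_ext
  ext v
  simp

lemma symAlgMap_mem (f : V →ₗ[K] V) (n : ℕ) {x : SymmetricAlgebra K V}
    (hx : x ∈ (LinearMap.range (SymmetricAlgebra.ι K V)) ^ n) :
    symAlgMap f x ∈ (LinearMap.range (SymmetricAlgebra.ι K V)) ^ n := by
  have h : (LinearMap.range (SymmetricAlgebra.ι K V)).map (symAlgMap f).toLinearMap ≤
      LinearMap.range (SymmetricAlgebra.ι K V) := by
    rintro _ ⟨_, ⟨v, rfl⟩, rfl⟩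
    exact ⟨f v, by simp⟩
  have h2 := pow_le_pow_left' h n
  rw [← Submodule.map_pow] at h2
  exact h2 (Submodule.mem_map_of_mem hx)

/-- The representation of `GL(V)` on `S^n V`. -/
def symRep (n : ℕ) : Representation K (LinearMap.GeneralLinearGroup K V) (SymPow K V n) where
  toFun g := (symAlgMap (g : V →ₗ[K] V)).toLinearMap.restrict fun _ hx => symAlgMap_mem _ n hx
  map_one' := by
    ext x
    simp [symAlgMap_one]
  map_mul' g h := by
    apply LinearMap.ext
    intro x
    apply Subtype.ext
    change symAlgMap ((g * h : LinearMap.GeneralLinearGroup K V) : V →ₗ[K] V) x.1 =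
      symAlgMap (g : V →ₗ[K] V) (symAlgMap (h : V →ₗ[K] V) x.1)
    rw [Units.val_mul, symAlgMap_mul]
    rfl

end SymmetricPowers

section PGL

variable (K : Type*) [Field K] (V : Type*) [AddCommGroup V] [Module K V]

/-- The subgroup of nonzero scalars in `GL(V)`. -/
def scalarSubgroup : Subgroup (LinearMap.GeneralLinearGroup K V) :=
  (Units.map (algebraMap K (Module.End K V)).toMonoidHom).range

instance : (scalarSubgroup K V).Normal where
  conj_mem := by
    rintro _ ⟨z, rfl⟩ g
    refine ⟨z, ?_⟩
    rw [eq_mul_inv_iff_mul_eq]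
    ext v
    simp

/-- The projective linear group `PGL(V) = GL(V) / Kˣ`. -/
abbrev PGL : Type _ := LinearMap.GeneralLinearGroup K V ⧸ scalarSubgroup K V

end PGL

section Grassmannian

/-- The Grassmannian of `k`-dimensional linear subspaces of `M`. -/
@[ext] structure Grass (K : Type*) [Field K] (k : ℕ) (M : Type*) [AddCommGroup M] [Module K M] where
  /-- the underlying subspace -/
  toSubmodule : Submodule K M
  finrank_eq : finrank K toSubmodule = k

variable (K : Type*) [Field K]

/-- The algebra of polynomial functions on a vector space: the algebra of functions that is
generated by the linear forms. -/
def polyFun (E : Type*) [AddCommGroup E] [Module K E] : Subalgebra K (E → K) :=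
  Algebra.adjoin K (Set.range fun (φ : Dual K E) (x : E) => φ x)

/-- The Zariski topology on a finite-dimensional vector space: the open sets are the unions of
sets `{f ≠ 0}` with `f` a polynomial function. -/
@[reducible] def zariski (E : Type*) [AddCommGroup E] [Module K E] : TopologicalSpace E where
  IsOpen U := ∀ x ∈ U, ∃ f ∈ polyFun K E, f x ≠ 0 ∧ ∀ y, f y ≠ 0 → y ∈ U
  isOpen_univ := fun _ _ => ⟨1, one_mem _, by simp, by simp⟩
  isOpen_inter := by
    rintro U U' h h' x ⟨hx, hx'⟩
    obtain ⟨f, hf, hfx, hfU⟩ := h x hx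
    obtain ⟨g, hg, hgx, hgU⟩ := h' x hx'
    refine ⟨f * g, mul_mem hf hg, mul_ne_zero hfx hgx, fun y hy => ?_⟩
    exact ⟨hfU y (left_ne_zero_of_mul hy), hgU y (right_ne_zero_of_mul hy)⟩
  isOpen_sUnion := by
    rintro s hs x ⟨U, hU, hx⟩
    obtain ⟨f, hf, hfx, hfU⟩ := hs U hU x hx
    exact ⟨f, hf, hfx, fun y hy => ⟨U, hU, hfU y hy⟩⟩

variable {K} {k : ℕ} {M : Type*} [AddCommGroup M] [Module K M]

/-- The subspace spanned by a linearly independent `k`-tuple (a frame), as a point of the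
Grassmannian. -/
def Grass.ofFrame (u : {u : Fin k → M // LinearIndependent K u}) : Grass K k M where
  toSubmodule := Submodule.span K (Set.range u.1)
  finrank_eq := by simpa using finrank_span_eq_card u.2

/-- The Zariski topology on the (closed points of the) Grassmannian. The variety of frames, an open
subvariety of the vector space `M^k`, is a Zariski-locally trivial `GL_k`-torsor over the
Grassmannian; in particular the Zariski topology of the Grassmannian is the quotient of the
Zariski topology on frames: a set of subspaces is open if and only if the set of all frames
spanning one of them is Zariski open. -/
instance : TopologicalSpace (Grass K k M) :=
  ((zariski K (Fin k → M)).induced Subtype.val).coinduced Grass.ofFrame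

/-- The action on the Grassmannian, `U ↦ g U`, induced by a representation of a group on `M`. -/
def Grass.permHom {G : Type*} [Group G] (k : ℕ) (ρ : Representation K G M) :
    G →* Equiv.Perm (Grass K k M) :=
  MonoidHom.toHomPerm
    { toFun := fun g U =>
        { toSubmodule := U.toSubmodule.map (ρ g)
          finrank_eq := by
            have hinj : Function.Injective (ρ g) := by
              apply Function.LeftInverse.injective (g := ρ g⁻¹)
              intro x
              simp [← Module.End.mul_apply, ← map_mul]
            exact (LinearEquiv.finrank_eq
              (Submodule.equivMapOfInjective (ρ g) hinj U.toSubmodule)).symm.trans U.finrank_eq }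
      map_one' := by
        funext U
        apply Grass.ext
        change U.toSubmodule.map (ρ 1) = U.toSubmodule
        rw [map_one, Module.End.one_eq_id, Submodule.map_id]
      map_mul' := fun g h => by
        funext U
        apply Grass.ext
        change U.toSubmodule.map (ρ (g * h)) = (U.toSubmodule.map (ρ h)).map (ρ g)
        rw [map_mul, Module.End.mul_eq_comp, Submodule.map_comp] }

end Grassmannian

section Action

variable {K : Type*} [Field K] {V : Type*} [AddCommGroup V] [Module K V]

/-- A scalar `z` acts on `S^n V` as multiplication by `z ^ n`. -/
lemma symRep_scalar (n : ℕ) (z : Kˣ) (x : SymPow K V n) :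
    symRep n (Units.map (algebraMap K (Module.End K V)).toMonoidHom z) x = (z : K) ^ n • x := by
  obtain ⟨x, hx⟩ := x
  apply Subtype.ext
  change symAlgMap _ x = (z : K) ^ n • x
  induction hx using Submodule.pow_induction_on_left' with
  | algebraMap r => simp
  | add x y i hx hy ihx ihy => rw [map_add, ihx, ihy, smul_add]
  | mem_mul m hm i x hx ih =>
    obtain ⟨v, rfl⟩ := hm
    rw [map_mul, ih, symAlgMap_ι]
    simp [pow_succ', smul_smul, mul_comm]

/-- The homomorphism from `PGL(V)` to the permutations of `Grass_k(S^n V ⊕ S^n V)` given by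
`[g] ↦ (U ↦ (S^n g ⊕ S^n g) U)`. -/
def pglHom (k n : ℕ) : PGL K V →* Equiv.Perm (Grass K k (SymPow K V n × SymPow K V n)) :=
  QuotientGroup.lift (scalarSubgroup K V)
    (Grass.permHom k ((symRep n).prod (symRep n))) <| by
      rintro _ ⟨z, rfl⟩
      rw [MonoidHom.mem_ker]
      ext1 U
      apply Grass.ext
      have hz : IsUnit ((z : K) ^ n) := z.isUnit.pow n
      have h : ((symRep n).prod (symRep n))
          (Units.map (algebraMap K (Module.End K V)).toMonoidHom z) =
          (z : K) ^ n • (LinearMap.id : (SymPow K V n × SymPow K V n) →ₗ[K] _) := by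
        apply LinearMap.ext
        rintro ⟨x, y⟩
        exact Prod.ext (symRep_scalar n z x) (symRep_scalar n z y)
      change U.toSubmodule.map (((symRep n).prod (symRep n)) _) = U.toSubmodule
      rw [h, Submodule.map_smul _ _ _ hz.ne_zero, Submodule.map_id]

/-- The natural action of `PGL(V)` on `Grass_k(S^n V ⊕ S^n V)`. -/
instance (k n : ℕ) : MulAction (PGL K V) (Grass K k (SymPow K V n × SymPow K V n)) :=
  MulAction.compHom _ (pglHom k n)

end Action

/-- The action of `G` on `X` is almost free if there is a dense open subset of `X` all of whose
points have trivial stabiliser. -/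
def IsAlmostFree (G X : Type*) [Group G] [MulAction G X] [TopologicalSpace X] : Prop :=
  ∃ X₀ : Set X, IsOpen X₀ ∧ Dense X₀ ∧ ∀ x ∈ X₀, MulAction.stabilizer G x = ⊥

end InstantonGrass

end

/-!
The theorem is proved by a dimension count. Let `M = S^n V ⊕ S^n V`, so that pairs of vectors of `M`
form a space of dimension `4 (n + 1)`. It suffices that the pairs which are linearly dependent, or span
a plane fixed by a nonscalar `g ∈ GL(V)`, form a thin set, i.e. that some nonzero polynomial function
vanishes on it (`isAlmostFree_of_isThin`). They lie in finitely many sets, each swept out by a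
polynomial map with fewer than `4 (n + 1)` parameters. Such a set is thin, because more polynomials
than variables are algebraically dependent (`IsThin.of_polyMaps`).

Let `g` be nonscalar and let `U ⊆ M` be a plane with `g U = U`. By `end_trichotomy`, `g` is either
diagonal with two distinct eigenvalues or a Jordan block, in a suitable basis of `V`.

* If `g` is diagonal, then so is its action on the monomial basis of `S^n V`, and a weight space
  involves no two consecutive monomials, hence at most `(n + 2) / 2` of them. The action on `U` is
  diagonalisable. If it is scalar, then `U` lies in one weight space of `M` (`supportedFrames`): two
  parameters for the eigenlines of `g` in `V` and at most `2 (n + 2)` coefficients, so at most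
  `2 n + 6` parameters. Otherwise `U` is spanned by vectors in two different weight spaces
  (`splitFrames`), which involve disjoint sets of monomials: two parameters for the eigenlines in `V`,
  two for those in `U`, and at most `2 (n + 1)` coefficients, again `2 n + 6` parameters.
* If `g` is a Jordan block, its only eigenvectors in `S^n V` are the multiples of the `n`-th power of
  its eigenvector `v`, so that `U` contains some `(α v ^ n, β v ^ n) ≠ 0` (`powerFrames`). One vector
  of the frame is then free, and the other one takes four more parameters: `2 n + 6` in all. With
  `α = β = 0` this family also contains the linearly dependent pairs.

The bound `2 n + 6 < 4 (n + 1)` is exactly `n ≥ 2`. It leaves little room for `n = 2`, which is why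
eigenlines are parametrised by normalised vectors, with one parameter each (`exists_smul_add_rev`).
-/

open Module

noncomputable section

namespace InstantonGrass

/-! ### Polynomial maps -/

section PolyMaps

variable {K : Type*} [Field K] {σ : Type*} {E F : Type*} [AddCommGroup E] [Module K E]
  [AddCommGroup F] [Module K F]

variable (K σ E) in
/-- The polynomial maps from the affine space `K^σ` to a vector space `E`, which may have infinite
dimension: the linear combinations of the maps `x ↦ p(x) • e` with `p` a polynomial in the variables
`σ` and `e ∈ E`. -/
def polyMaps : Submodule K ((σ → K) → E) :=
  Submodule.span K
    (Set.range fun (pe : MvPolynomial σ K × E) (x : σ → K) => MvPolynomial.eval x pe.1 • pe.2)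

lemma polyMaps_eval_smul (p : MvPolynomial σ K) (e : E) :
    (fun x => MvPolynomial.eval x p • e) ∈ polyMaps K σ E :=
  Submodule.subset_span ⟨(p, e), rfl⟩

lemma polyMaps_const (e : E) : (fun _ => e) ∈ polyMaps K σ E := by
  simpa using polyMaps_eval_smul (σ := σ) (1 : MvPolynomial σ K) e

lemma polyMaps_coord (i : σ) : (fun x => x i) ∈ polyMaps K σ K := by
  simpa using polyMaps_eval_smul (MvPolynomial.X i : MvPolynomial σ K) (1 : K)

lemma polyMaps_add {φ ψ : (σ → K) → E} (hφ : φ ∈ polyMaps K σ E) (hψ : ψ ∈ polyMaps K σ E) :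
    (fun x => φ x + ψ x) ∈ polyMaps K σ E :=
  add_mem hφ hψ

lemma polyMaps_sum {ι : Type*} (s : Finset ι) {φ : ι → (σ → K) → E}
    (hφ : ∀ i, φ i ∈ polyMaps K σ E) : (fun x => ∑ i ∈ s, φ i x) ∈ polyMaps K σ E := by
  have h := sum_mem (t := s) fun i _ => hφ i
  convert h using 1
  ext x
  simp

lemma polyMaps_linear (L : E →ₗ[K] F) {φ : (σ → K) → E} (hφ : φ ∈ polyMaps K σ E) :
    (fun x => L (φ x)) ∈ polyMaps K σ F := by
  induction hφ using Submodule.span_induction with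
  | mem _ h =>
    obtain ⟨⟨p, e⟩, rfl⟩ := h
    simpa using polyMaps_eval_smul p (L e)
  | zero => simpa using polyMaps_const (K := K) (σ := σ) (0 : F)
  | add φ ψ _ _ hφ hψ => simpa using polyMaps_add hφ hψ
  | smul c φ _ hφ =>
    convert (polyMaps K σ F).smul_mem c hφ using 1
    ext x
    simp

lemma polyMaps_exists_eval {φ : (σ → K) → K} (hφ : φ ∈ polyMaps K σ K) :
    ∃ p : MvPolynomial σ K, ∀ x, φ x = MvPolynomial.eval x p := by
  induction hφ using Submodule.span_induction with
  | mem _ h =>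
    obtain ⟨⟨p, e⟩, rfl⟩ := h
    exact ⟨p * MvPolynomial.C e, by simp⟩
  | zero => exact ⟨0, by simp⟩
  | add φ ψ _ _ hφ hψ =>
    obtain ⟨p, hp⟩ := hφ
    obtain ⟨q, hq⟩ := hψ
    exact ⟨p + q, by simp [hp, hq]⟩
  | smul c φ _ hφ =>
    obtain ⟨p, hp⟩ := hφ
    exact ⟨MvPolynomial.C c * p, by simp [hp]⟩

lemma polyMaps_smul {φ : (σ → K) → K} {ψ : (σ → K) → E} (hφ : φ ∈ polyMaps K σ K)
    (hψ : ψ ∈ polyMaps K σ E) : (fun x => φ x • ψ x) ∈ polyMaps K σ E := by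
  obtain ⟨p, hp⟩ := polyMaps_exists_eval hφ
  simp_rw [hp]
  induction hψ using Submodule.span_induction with
  | mem _ h =>
    obtain ⟨⟨q, e⟩, rfl⟩ := h
    simpa [smul_smul] using polyMaps_eval_smul (p * q) e
  | zero => simpa using polyMaps_const (K := K) (σ := σ) (0 : E)
  | add φ ψ _ _ hφ hψ => simpa using polyMaps_add hφ hψ
  | smul c φ _ hφ =>
    convert (polyMaps K σ E).smul_mem c hφ using 1
    ext x
    simp [smul_comm c]

lemma polyMaps_prodMk {φ : (σ → K) → E} {ψ : (σ → K) → F} (hφ : φ ∈ polyMaps K σ E)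
    (hψ : ψ ∈ polyMaps K σ F) : (fun x => (φ x, ψ x)) ∈ polyMaps K σ (E × F) := by
  simpa using polyMaps_add (polyMaps_linear (LinearMap.inl K E F) hφ)
    (polyMaps_linear (LinearMap.inr K E F) hψ)

lemma polyMaps_pi {ι : Type*} [Fintype ι] {φ : ι → (σ → K) → E}
    (hφ : ∀ i, φ i ∈ polyMaps K σ E) : (fun x i => φ i x) ∈ polyMaps K σ (ι → E) := by
  classical
  convert polyMaps_sum Finset.univ fun i => polyMaps_linear (LinearMap.single K (fun _ => E) i) (hφ i)
    using 1
  ext x i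
  simp [Finset.sum_apply, Pi.single_apply]

variable {A : Type*} [CommRing A] [Algebra K A]

lemma polyMaps_mul {φ ψ : (σ → K) → A} (hφ : φ ∈ polyMaps K σ A) (hψ : ψ ∈ polyMaps K σ A) :
    (fun x => φ x * ψ x) ∈ polyMaps K σ A := by
  induction hφ using Submodule.span_induction with
  | mem _ h =>
    obtain ⟨⟨p, e⟩, rfl⟩ := h
    have hp : (fun x => MvPolynomial.eval x p) ∈ polyMaps K σ K := by
      simpa using polyMaps_eval_smul p (1 : K)
    simpa using polyMaps_smul hp (polyMaps_linear (LinearMap.mulLeft K e) hψ)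
  | zero => simpa using polyMaps_const (K := K) (σ := σ) (0 : A)
  | add φ φ' _ _ hφ hφ' => simpa [add_mul] using polyMaps_add hφ hφ'
  | smul c φ _ hφ =>
    convert (polyMaps K σ A).smul_mem c hφ using 1
    ext x
    simp

lemma polyMaps_pow {φ : (σ → K) → A} (hφ : φ ∈ polyMaps K σ A) (m : ℕ) :
    (fun x => φ x ^ m) ∈ polyMaps K σ A := by
  induction m with
  | zero => simpa using polyMaps_const (1 : A)
  | succ m ih => simpa [pow_succ] using polyMaps_mul ih hφ

end PolyMaps

/-! ### Thin sets and the dimension count -/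

section Thin

variable {K : Type*} [Field K] {E F : Type*} [AddCommGroup E] [Module K E]
  [AddCommGroup F] [Module K F]

lemma polyFun_comp_linear (L : E →ₗ[K] F) {f : F → K} (hf : f ∈ polyFun K F) :
    (fun x => f (L x)) ∈ polyFun K E := by
  induction hf using Algebra.adjoin_induction with
  | mem _ h =>
    obtain ⟨φ, rfl⟩ := h
    exact Algebra.subset_adjoin ⟨φ ∘ₗ L, rfl⟩
  | algebraMap r => exact (polyFun K E).algebraMap_mem r
  | add f g _ _ hf hg => exact add_mem hf hg
  | mul f g _ _ hf hg => exact mul_mem hf hg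

lemma eval_repr_mem_polyFun {ι : Type*} [Fintype ι] (b : Basis ι K E) (p : MvPolynomial ι K) :
    (fun x => MvPolynomial.eval (fun i => b.repr x i) p) ∈ polyFun K E := by
  induction p using MvPolynomial.induction_on with
  | C a =>
    simp only [MvPolynomial.eval_C]
    exact (polyFun K E).algebraMap_mem a
  | add p q hp hq =>
    simp only [map_add]
    exact add_mem hp hq
  | mul_X p i hp =>
    simp only [map_mul, MvPolynomial.eval_X]
    exact mul_mem hp (Algebra.subset_adjoin (R := K) ⟨b.coord i, rfl⟩)

lemma exists_eval_repr_of_mem_polyFun {ι : Type*} [Fintype ι] (b : Basis ι K E) {f : E → K}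
    (hf : f ∈ polyFun K E) :
    ∃ p : MvPolynomial ι K, ∀ x, f x = MvPolynomial.eval (fun i => b.repr x i) p := by
  induction hf using Algebra.adjoin_induction with
  | mem _ h =>
    obtain ⟨φ, rfl⟩ := h
    refine ⟨∑ i, MvPolynomial.C (φ (b i)) * MvPolynomial.X i, fun x => ?_⟩
    change φ x = _
    conv_lhs => rw [← b.sum_repr x]
    rw [map_sum, map_sum]
    simp [mul_comm]
  | algebraMap r => exact ⟨MvPolynomial.C r, by simp⟩
  | add f g _ _ hf hg =>
    obtain ⟨p, hp⟩ := hf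
    obtain ⟨q, hq⟩ := hg
    exact ⟨p + q, by simp [hp, hq]⟩
  | mul f g _ _ hf hg =>
    obtain ⟨p, hp⟩ := hf
    obtain ⟨q, hq⟩ := hg
    exact ⟨p * q, by simp [hp, hq]⟩

/-- Irreducibility of affine space: over an infinite field the polynomial functions form a domain. -/
lemma polyFun_mul_ne_zero [Infinite K] [FiniteDimensional K E] {f g : E → K}
    (hf : f ∈ polyFun K E) (hg : g ∈ polyFun K E) (hf0 : f ≠ 0) (hg0 : g ≠ 0) : f * g ≠ 0 := by
  let b := finBasis K E
  obtain ⟨p, hp⟩ := exists_eval_repr_of_mem_polyFun b hf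
  obtain ⟨q, hq⟩ := exists_eval_repr_of_mem_polyFun b hg
  intro h
  have hpq : p * q = 0 := by
    apply MvPolynomial.funext
    intro y
    have := congrFun h (b.equivFun.symm y)
    simp only [Pi.mul_apply, hp, hq, Pi.zero_apply] at this
    rw [map_mul, map_zero, ← this]
    have hy : (fun i => b.repr (b.equivFun.symm y) i) = y := b.equivFun.apply_symm_apply y
    rw [hy]
  rcases mul_eq_zero.mp hpq with rfl | rfl
  · exact hf0 (funext fun x => by simp [hp])
  · exact hg0 (funext fun x => by simp [hq])

variable (K) in
/-- A subset of a vector space is thin if it is not Zariski dense: some nonzero polynomial function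
vanishes on it. -/
def IsThin (B : Set E) : Prop := ∃ f ∈ polyFun K E, f ≠ 0 ∧ ∀ x ∈ B, f x = 0

lemma IsThin.mono {B C : Set E} (hC : IsThin K C) (h : B ⊆ C) : IsThin K B := by
  obtain ⟨f, hf, hf0, hfC⟩ := hC
  exact ⟨f, hf, hf0, fun x hx => hfC x (h hx)⟩

lemma IsThin.union [Infinite K] [FiniteDimensional K E] {B C : Set E} (hB : IsThin K B)
    (hC : IsThin K C) : IsThin K (B ∪ C) := by
  obtain ⟨f, hf, hf0, hfB⟩ := hB
  obtain ⟨g, hg, hg0, hgC⟩ := hC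
  refine ⟨f * g, mul_mem hf hg, polyFun_mul_ne_zero hf hg hf0 hg0, ?_⟩
  rintro x (hx | hx)
  · simp [hfB x hx]
  · simp [hgC x hx]

lemma IsThin.iUnion [Infinite K] [FiniteDimensional K E] {ι : Type*} [Finite ι] {B : ι → Set E}
    (h : ∀ i, IsThin K (B i)) : IsThin K (⋃ i, B i) := by
  choose f hf hf0 hfB using h
  have := Fintype.ofFinite ι
  have key : ∀ s : Finset ι, ∏ i ∈ s, f i ∈ polyFun K E ∧ ∏ i ∈ s, f i ≠ 0 := by
    intro s
    induction s using Finset.cons_induction with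
    | empty => exact ⟨one_mem _, one_ne_zero⟩
    | cons i s his ih =>
      rw [Finset.prod_cons]
      exact ⟨mul_mem (hf i) ih.1, polyFun_mul_ne_zero (hf i) ih.1 (hf0 i) ih.2⟩
  refine ⟨∏ i, f i, (key _).1, (key _).2, fun x hx => ?_⟩
  obtain ⟨i, hi⟩ := Set.mem_iUnion.mp hx
  rw [Finset.prod_apply]
  exact Finset.prod_eq_zero (Finset.mem_univ i) (hfB i x hi)

/-- The dimension count: fewer parameters than the dimension of `E` sweep out a thin subset of `E`,
since more polynomials than variables are algebraically dependent. The parametrisation may take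
values in a larger space `F` that contains `E` via `j`. -/
lemma IsThin.of_polyMaps [Infinite K] [FiniteDimensional K E] {σ : Type*} [Fintype σ]
    (hσ : Fintype.card σ < finrank K E) {j : E →ₗ[K] F} (hj : Function.Injective j)
    {φ : (σ → K) → F} (hφ : φ ∈ polyMaps K σ F) {B : Set E} (hB : ∀ u ∈ B, ∃ x, j u = φ x) :
    IsThin K B := by
  obtain ⟨r, hr⟩ := j.exists_leftInverse_of_injective (LinearMap.ker_eq_bot.mpr hj)
  let b := finBasis K E
  have hcoord : ∀ i, ∃ p : MvPolynomial σ K, ∀ x, b.repr (r (φ x)) i = MvPolynomial.eval x p :=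
    fun i => polyMaps_exists_eval (polyMaps_linear (b.coord i ∘ₗ r) hφ)
  choose p hp using hcoord
  have hdep : ¬ AlgebraicIndependent K p := by
    intro h
    have h1 := h.lift_cardinalMk_le_trdeg
    rw [MvPolynomial.trdeg_of_isDomain] at h1
    simp only [Cardinal.mk_fintype, Fintype.card_fin, Cardinal.lift_natCast, Nat.cast_le] at h1
    omega
  rw [algebraicIndependent_iff] at hdep
  push Not at hdep
  obtain ⟨q, hq, hq0⟩ := hdep
  refine ⟨_, eval_repr_mem_polyFun b q, fun h => hq0 ?_, fun u hu => ?_⟩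
  · apply MvPolynomial.funext
    intro y
    have := congrFun h (b.equivFun.symm y)
    have hy : (fun i => b.repr (b.equivFun.symm y) i) = y := b.equivFun.apply_symm_apply y
    rw [map_zero]
    rwa [hy] at this
  · obtain ⟨x, hx⟩ := hB u hu
    have hu' : u = r (φ x) := by rw [← hx]; exact (LinearMap.congr_fun hr u).symm
    have := congrArg (MvPolynomial.eval x) hq
    rw [map_zero, MvPolynomial.aeval_def, MvPolynomial.eval₂_eq', map_sum] at this
    rw [← this, MvPolynomial.eval_eq']
    refine Finset.sum_congr rfl fun d _ => ?_
    simp [hu', hp]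

end Thin

/-! ### Almost free actions on Grassmannians -/

section Grassmannian

variable {K : Type*} [Field K] {k : ℕ} {M : Type*} [AddCommGroup M] [Module K M]

lemma Grass.isOpen_iff (X : Set (Grass K k M)) :
    IsOpen X ↔ ∃ W : Set (Fin k → M), @IsOpen _ (zariski K (Fin k → M)) W ∧
      ∀ u : {u : Fin k → M // LinearIndependent K u}, u.1 ∈ W ↔ Grass.ofFrame u ∈ X := by
  constructor
  · rintro ⟨W, hW, h⟩
    exact ⟨W, hW, fun u => Set.ext_iff.mp h u⟩
  · rintro ⟨W, hW, h⟩
    exact ⟨W, hW, Set.ext h⟩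

lemma Grass.ofFrame_surjective [FiniteDimensional K M] :
    Function.Surjective (Grass.ofFrame : _ → Grass K k M) := by
  intro U
  let b : Basis (Fin k) K U.toSubmodule := finBasisOfFinrankEq K U.toSubmodule U.finrank_eq
  have hb : LinearIndependent K (U.toSubmodule.subtype ∘ b) :=
    b.linearIndependent.map' _ U.toSubmodule.ker_subtype
  refine ⟨⟨_, hb⟩, ?_⟩
  apply Grass.ext
  change Submodule.span K (Set.range (U.toSubmodule.subtype ∘ b)) = _
  rw [Set.range_comp, Submodule.span_image, b.span_eq, Submodule.map_top, Submodule.range_subtype]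

/-- If the frames that are degenerate or span a point with nontrivial stabiliser form a thin set,
then the action is almost free. The dense open set is the image of the nonvanishing locus of a
polynomial function; its preimage in the space of frames is a union of `GL_k`-translates of that
locus, hence open. -/
lemma isAlmostFree_of_isThin [Infinite K] [FiniteDimensional K M] {G : Type*} [Group G]
    [MulAction G (Grass K k M)]
    (h : IsThin K {u : Fin k → M | ∀ hu : LinearIndependent K u,
      MulAction.stabilizer G (Grass.ofFrame ⟨u, hu⟩) ≠ ⊥}) :
    IsAlmostFree G (Grass K k M) := by
  obtain ⟨f, hf, hf0, hfB⟩ := h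
  have hgood : ∀ u, f u ≠ 0 → ∃ hu : LinearIndependent K u,
      MulAction.stabilizer G (Grass.ofFrame ⟨u, hu⟩) = ⊥ := by
    intro u hu
    by_contra! hcon
    exact hu (hfB u hcon)
  refine ⟨Grass.ofFrame '' {u | f u.1 ≠ 0}, ?_, ?_, ?_⟩
  · rw [Grass.isOpen_iff]
    -- Any other frame of the span of `u` is obtained from `u` by a matrix `c`.
    refine ⟨{u | ∃ c : Matrix (Fin k) (Fin k) K, f (fun i => ∑ j, c i j • u j) ≠ 0}, ?_, ?_⟩
    · rintro u ⟨c, hc⟩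
      let L : (Fin k → M) →ₗ[K] (Fin k → M) :=
        LinearMap.pi fun i => ∑ j, c i j • LinearMap.proj j
      have hL : ∀ y, L y = fun i => ∑ j, c i j • y j := fun y => by
        ext i
        simp [L]
      refine ⟨_, polyFun_comp_linear L hf, ?_, fun y hy => ⟨c, ?_⟩⟩
      · rwa [hL]
      · rwa [hL] at hy
    · intro u
      constructor
      · rintro ⟨c, hc⟩
        obtain ⟨hu', -⟩ := hgood _ hc
        refine ⟨⟨_, hu'⟩, hc, ?_⟩
        apply Grass.ext
        have hle : Submodule.span K (Set.range fun i => ∑ j, c i j • u.1 j) ≤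
            Submodule.span K (Set.range u.1) := by
          rw [Submodule.span_le]
          rintro _ ⟨i, rfl⟩
          exact Submodule.sum_mem _ fun j _ =>
            Submodule.smul_mem _ _ (Submodule.subset_span (Set.mem_range_self j))
        exact Submodule.eq_of_le_of_finrank_eq hle
          ((Grass.ofFrame ⟨_, hu'⟩).finrank_eq.trans (Grass.ofFrame u).finrank_eq.symm)
      · rintro ⟨u', hu', heq⟩
        have hspan : Submodule.span K (Set.range u'.1) = Submodule.span K (Set.range u.1) :=
          congrArg Grass.toSubmodule heq
        have hmem : ∀ i, ∃ c : Fin k → K, ∑ j, c j • u.1 j = u'.1 i := fun i => by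
          rw [← Submodule.mem_span_range_iff_exists_fun, ← hspan]
          exact Submodule.subset_span ⟨i, rfl⟩
        choose c hc using hmem
        refine ⟨c, ?_⟩
        simp only [hc]
        exact hu'
  · rw [dense_iff_inter_open]
    rintro O hO ⟨U, hU⟩
    obtain ⟨W, hW, hWO⟩ := (Grass.isOpen_iff O).mp hO
    obtain ⟨u₀, rfl⟩ := Grass.ofFrame_surjective U
    obtain ⟨g, hg, hgu₀, hgW⟩ := hW u₀.1 ((hWO u₀).mpr hU)
    obtain ⟨u, hu⟩ := Function.ne_iff.mp
      (polyFun_mul_ne_zero hf hg hf0 fun h0 => hgu₀ (congrFun h0 _))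
    have hfu : f u ≠ 0 := left_ne_zero_of_mul hu
    obtain ⟨hind, -⟩ := hgood u hfu
    exact ⟨Grass.ofFrame ⟨u, hind⟩, (hWO ⟨u, hind⟩).mp (hgW u (right_ne_zero_of_mul hu)),
      ⟨u, hind⟩, hfu, rfl⟩
  · rintro _ ⟨u, hu, rfl⟩
    exact (hgood u.1 hu).2

end Grassmannian

/-! ### Endomorphisms of a plane -/

section Trichotomy

variable {K : Type*} [Field K] {W : Type*} [AddCommGroup W] [Module K W]

/-- An endomorphism of a plane over an algebraically closed field is a scalar, or diagonalisable with
distinct eigenvalues, or a Jordan block up to the normalisation of the entry above the diagonal. -/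
lemma end_trichotomy [IsAlgClosed K] (hW : finrank K W = 2) (T : W →ₗ[K] W) :
    (∃ t : K, ∀ w, T w = t • w) ∨
    (∃ (b : Basis (Fin 2) K W) (t : Fin 2 → K), t 0 ≠ t 1 ∧ ∀ i, T (b i) = t i • b i) ∨
    (∃ (b : Basis (Fin 2) K W) (t s : K), s ≠ 0 ∧ T (b 0) = t • b 0 ∧
      T (b 1) = t • b 1 + s • b 0) := by
  have : FiniteDimensional K W := FiniteDimensional.of_finrank_pos (by omega)
  have : Nontrivial W := nontrivial_of_finrank_pos (R := K) (by omega)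
  obtain ⟨t₀, ht₀⟩ := Module.End.exists_eigenvalue T
  obtain ⟨v, hv⟩ := ht₀.exists_hasEigenvector
  have hTv : T v = t₀ • v := hv.apply_eq_smul
  have hv0 : v ≠ 0 := hv.2
  have mkBasis : ∀ w : W, LinearIndependent K ![v, w] →
      ∃ b : Basis (Fin 2) K W, b 0 = v ∧ b 1 = w := fun w hw =>
    ⟨basisOfLinearIndependentOfCardEqFinrank hw (by simp [hW]), by simp, by simp⟩
  obtain ⟨w, hw⟩ := exists_linearIndependent_pair_of_one_lt_finrank (R := K) (by omega) hv0
  obtain ⟨b, hb0, hb1⟩ := mkBasis w hw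
  obtain ⟨s, t₁, hTw⟩ : ∃ s t₁ : K, T w = s • v + t₁ • w := by
    refine ⟨b.repr (T w) 0, b.repr (T w) 1, ?_⟩
    conv_lhs => rw [← b.sum_repr (T w)]
    rw [Fin.sum_univ_two, hb0, hb1]
  by_cases ht : t₁ = t₀
  · subst ht
    by_cases hs : s = 0
    · refine Or.inl ⟨t₁, fun x => ?_⟩
      have hTw' : T w = t₁ • w := by simpa [hs] using hTw
      rw [← b.sum_repr x, Fin.sum_univ_two, hb0, hb1, map_add, map_smul, map_smul, hTv, hTw']
      module
    · exact Or.inr (Or.inr ⟨b, t₁, s, hs, by rw [hb0, hTv], by rw [hb0, hb1, hTw, add_comm]⟩)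
  · -- The second eigenvector is `w` plus a multiple of `v`.
    have ht' : t₁ - t₀ ≠ 0 := sub_ne_zero.mpr ht
    have hw' : LinearIndependent K ![v, (s / (t₁ - t₀)) • v + w] := by
      rw [LinearIndependent.pair_iff] at hw ⊢
      intro x y hxy
      have := hw (x + y * (s / (t₁ - t₀))) y (by rw [← hxy]; module)
      obtain ⟨h1, rfl⟩ := this
      exact ⟨by simpa using h1, rfl⟩
    obtain ⟨b', hb0', hb1'⟩ := mkBasis _ hw'
    refine Or.inr (Or.inl ⟨b', ![t₀, t₁], by simpa using fun h => ht h.symm, fun i => ?_⟩)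
    fin_cases i
    · simpa [hb0'] using hTv
    · have : t₀ * (s / (t₁ - t₀)) + s = t₁ * (s / (t₁ - t₀)) := by
        field_simp
        ring
      simp only [Fin.mk_one, hb1', map_add, map_smul, hTv, hTw, Matrix.cons_val_one,
        Matrix.cons_val_fin_one]
      rw [smul_add, smul_smul, smul_smul, ← this]
      module

/-- Every vector of a plane with basis `e` is a multiple of some `e i + r • e j` with `{i, j} = {0, 1}`;
these vectors depend on one parameter `r` only. -/
lemma exists_smul_add_rev (e : Basis (Fin 2) K W) (w : W) :
    ∃ (i : Fin 2) (r c : K), w = c • (e i + r • e i.rev) := by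
  have hw := e.sum_repr w
  rw [Fin.sum_univ_two] at hw
  by_cases h : e.repr w 0 = 0
  · refine ⟨1, 0, e.repr w 1, ?_⟩
    rw [h] at hw
    rw [← hw]
    simp
  · refine ⟨0, e.repr w 1 / e.repr w 0, e.repr w 0, ?_⟩
    conv_lhs => rw [← hw]
    rw [smul_add, smul_smul, mul_div_cancel₀ _ h]
    simp [Fin.rev]

end Trichotomy

/-! ### Monomials in `S^n V` -/

section Monomials

variable {K : Type*} [Field K] {V : Type*} [AddCommGroup V] [Module K V]

open Polynomial in
/-- Dehomogenisation with respect to a basis `b` of a plane: the algebra homomorphism from the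
symmetric algebra to `K[X]` that maps `b 0` to `1` and `b 1` to `X`. It is injective on every
`S^n V`. -/
def dehom (b : Basis (Fin 2) K V) : SymmetricAlgebra K V →ₐ[K] K[X] :=
  SymmetricAlgebra.lift (b.constr K ![1, X])

@[simp] lemma dehom_ι_zero (b : Basis (Fin 2) K V) :
    dehom b (SymmetricAlgebra.ι K V (b 0)) = 1 := by
  simp [dehom]

@[simp] lemma dehom_ι_one (b : Basis (Fin 2) K V) :
    dehom b (SymmetricAlgebra.ι K V (b 1)) = Polynomial.X := by
  simp [dehom]

/-- The monomial `(b 0) ^ (n - k) (b 1) ^ k` in `S^n V`. -/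
def mono (b : Fin 2 → V) (n : ℕ) (k : Fin (n + 1)) : SymPow K V n :=
  ⟨SymmetricAlgebra.ι K V (b 0) ^ (n - k : ℕ) * SymmetricAlgebra.ι K V (b 1) ^ (k : ℕ), by
    have h := Submodule.mul_mem_mul
      (Submodule.pow_mem_pow _ (LinearMap.mem_range_self (SymmetricAlgebra.ι K V) (b 0)) (n - k))
      (Submodule.pow_mem_pow _ (LinearMap.mem_range_self (SymmetricAlgebra.ι K V) (b 1)) k)
    rwa [← pow_add, Nat.sub_add_cancel (Nat.lt_succ_iff.mp k.2)] at h⟩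

lemma dehom_mono (b : Basis (Fin 2) K V) (n : ℕ) (k : Fin (n + 1)) :
    dehom b (mono b n k : SymPow K V n) = Polynomial.X ^ (k : ℕ) := by
  simp [mono]

open scoped Pointwise in
lemma span_mono (b : Basis (Fin 2) K V) (n : ℕ) :
    Submodule.span K (Set.range (mono (K := K) b n)) = ⊤ := by
  have hrange : LinearMap.range (SymmetricAlgebra.ι K V) =
      Submodule.span K {SymmetricAlgebra.ι K V (b 0), SymmetricAlgebra.ι K V (b 1)} := by
    rw [LinearMap.range_eq_map, ← b.span_eq, Submodule.map_span, ← Set.range_comp]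
    congr 1
    ext x
    simp [Fin.exists_fin_two, eq_comm]
  have key : ∀ m : ℕ, (LinearMap.range (SymmetricAlgebra.ι K V)) ^ m ≤
      Submodule.span K (Set.range fun k : Fin (m + 1) => (mono (K := K) b m k).1) := by
    intro m
    have hpow := congrArg (· ^ m) hrange
    rw [Submodule.span_pow] at hpow
    refine hpow.le.trans (Submodule.span_mono fun x hx => ?_)
    clear hrange hpow
    induction m generalizing x with
    | zero =>
      rw [pow_zero, Set.mem_one] at hx
      exact ⟨0, by simp [mono, hx]⟩
    | succ m ih =>
      rw [pow_succ] at hx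
      obtain ⟨y, hy, z, hz, rfl⟩ := Set.mem_mul.mp hx
      obtain ⟨k, rfl⟩ := ih _ hy
      have hk := Nat.lt_succ_iff.mp k.2
      rcases hz with rfl | rfl
      · refine ⟨k.castSucc, ?_⟩
        simp only [mono, Fin.val_castSucc]
        rw [Nat.succ_sub hk, pow_succ]
        ring
      · refine ⟨k.succ, ?_⟩
        simp only [mono, Fin.val_succ]
        rw [Nat.add_sub_add_right, pow_succ]
        ring
  rw [eq_top_iff]
  rintro ⟨x, hx⟩ -
  have := key n hx
  change x ∈ Submodule.span K (Set.range (Subtype.val ∘ mono (K := K) b n)) at this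
  rw [Set.range_comp] at this
  change x ∈ Submodule.span K ((Submodule.subtype _) '' _) at this
  rw [Submodule.span_image] at this
  obtain ⟨y, hy, rfl⟩ := this
  exact hy

lemma linearIndependent_mono (b : Basis (Fin 2) K V) (n : ℕ) :
    LinearIndependent K (mono (K := K) b n) := by
  apply LinearIndependent.of_comp ((dehom b).toLinearMap ∘ₗ Submodule.subtype _)
  have h := (Polynomial.basisMonomials K).linearIndependent.comp (fun k : Fin (n + 1) => (k : ℕ))
    Fin.val_injective
  have heq : ((dehom b).toLinearMap ∘ₗ Submodule.subtype _) ∘ mono (K := K) b n =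
      Polynomial.basisMonomials K ∘ fun k : Fin (n + 1) => (k : ℕ) := by
    ext1 k
    simp [dehom_mono, Polynomial.X_pow_eq_monomial]
  rw [heq]
  exact h

/-- The basis of `S^n V` consisting of the monomials in a basis of the plane `V`. -/
def monoBasis (b : Basis (Fin 2) K V) (n : ℕ) : Basis (Fin (n + 1)) K (SymPow K V n) :=
  Basis.mk (linearIndependent_mono b n) (span_mono b n).ge

lemma monoBasis_apply (b : Basis (Fin 2) K V) (n : ℕ) (k : Fin (n + 1)) :
    monoBasis b n k = mono b n k := by
  simp [monoBasis]

lemma finrank_symPow (b : Basis (Fin 2) K V) (n : ℕ) : finrank K (SymPow K V n) = n + 1 := by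
  simpa using finrank_eq_card_basis (monoBasis b n)

lemma coeff_dehom (b : Basis (Fin 2) K V) (n : ℕ) (x : SymPow K V n) (k : Fin (n + 1)) :
    (dehom b (x : SymmetricAlgebra K V)).coeff k = (monoBasis b n).repr x k := by
  conv_lhs => rw [← (monoBasis b n).sum_repr x]
  rw [AddSubmonoidClass.coe_finsetSum, map_sum, Polynomial.finsetSum_coeff]
  simp [monoBasis_apply, dehom_mono, Polynomial.coeff_X_pow, Fin.val_inj]

lemma symRep_coe (n : ℕ) (g : LinearMap.GeneralLinearGroup K V) (x : SymPow K V n) :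
    (symRep n g x : SymmetricAlgebra K V) = symAlgMap (g : V →ₗ[K] V) x := rfl

/-- A diagonal `g` scales each monomial. -/
lemma repr_symRep_of_diagonal (b : Basis (Fin 2) K V) (n : ℕ)
    {g : LinearMap.GeneralLinearGroup K V} {t : Fin 2 → K}
    (hg : ∀ i, (g : V →ₗ[K] V) (b i) = t i • b i) (x : SymPow K V n) (k : Fin (n + 1)) :
    (monoBasis b n).repr (symRep n g x) k =
      t 0 ^ (n - k : ℕ) * t 1 ^ (k : ℕ) * (monoBasis b n).repr x k := by
  have hmono : ∀ l, symRep n g (monoBasis b n l) =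
      (t 0 ^ (n - l : ℕ) * t 1 ^ (l : ℕ)) • monoBasis b n l := by
    intro l
    apply Subtype.ext
    rw [symRep_coe, monoBasis_apply]
    simp [mono, hg, smul_pow, smul_smul, mul_comm]
  conv_lhs => rw [← (monoBasis b n).sum_repr x]
  simp only [map_sum, map_smul, hmono]
  simp [Finsupp.single_apply, mul_comm]

open Polynomial in
/-- A polynomial that a nontrivial translation multiplies by a scalar is constant: the orbit of a
root would consist of infinitely many roots. -/
lemma natDegree_eq_zero_of_comp_X_add_C [IsAlgClosed K] [CharZero K] {f : K[X]} {a μ χ : K}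
    (ha : a ≠ 0) (hμ : μ ≠ 0) (h : C μ * f.comp (X + C a) = C χ * f) : f.natDegree = 0 := by
  by_contra hdeg
  have hf0 : f ≠ 0 := fun h0 => hdeg (by simp [h0])
  obtain ⟨z, hz⟩ := IsAlgClosed.exists_root f fun h0 =>
    hdeg (natDegree_eq_zero_iff_degree_le_zero.mpr h0.le)
  have hroot : ∀ m : ℕ, f.IsRoot (z + m * a) := by
    intro m
    induction m with
    | zero => simpa using hz
    | succ m ih =>
      have := congrArg (eval (z + m * a)) h
      simp only [eval_mul, eval_C, eval_comp, eval_add, eval_X, ih.eq_zero, mul_zero,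
        mul_eq_zero, hμ, false_or] at this
      rw [IsRoot, ← this]
      push_cast
      ring_nf
  refine hf0 (eq_zero_of_infinite_isRoot f ?_)
  refine Set.infinite_of_injective_forall_mem (f := fun m : ℕ => z + m * a) ?_ hroot
  intro m m' hm
  simpa [ha] using hm

open Polynomial in
/-- The eigenvectors in `S^n V` of a Jordan block are the multiples of `(b 0) ^ n`. -/
lemma eigenvector_of_jordan [IsAlgClosed K] [CharZero K] (b : Basis (Fin 2) K V) (n : ℕ)
    {g : LinearMap.GeneralLinearGroup K V} {t s : K} (ht : t ≠ 0) (hs : s ≠ 0)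
    (hg0 : (g : V →ₗ[K] V) (b 0) = t • b 0) (hg1 : (g : V →ₗ[K] V) (b 1) = t • b 1 + s • b 0)
    {x : SymPow K V n} {χ : K} (hx : symRep n g x = χ • x) : ∃ c : K, x = c • mono b n 0 := by
  have hcomp : ∀ y : SymPow K V n, dehom b (symRep n g y : SymmetricAlgebra K V) =
      C (t ^ n) * (dehom b (y : SymmetricAlgebra K V)).comp (X + C (s / t)) := by
    intro y
    have hy : y ∈ Submodule.span K (Set.range (mono (K := K) b n)) := by
      rw [span_mono]
      trivial
    induction hy using Submodule.span_induction with
    | mem y h =>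
      obtain ⟨k, rfl⟩ := h
      have hk := Nat.lt_succ_iff.mp k.2
      have hlin : C t * (X + C (s / t)) = C t * X + C s := by
        rw [mul_add, ← C_mul, mul_div_cancel₀ _ ht]
      have hpow : t ^ n = t ^ (n - k : ℕ) * t ^ (k : ℕ) := by
        rw [← pow_add, Nat.sub_add_cancel hk]
      rw [symRep_coe, dehom_mono, X_pow_comp, hpow, C_mul, mul_assoc, C_pow, C_pow, ← mul_pow, hlin]
      simp [mono, hg0, hg1, smul_eq_C_mul]
    | zero => simp
    | add y z _ _ hy hz => simp [hy, hz, mul_add]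
    | smul c y _ hy => simp [hy, smul_eq_C_mul, mul_left_comm]
  have hdeg := natDegree_eq_zero_of_comp_X_add_C (div_ne_zero hs ht) (pow_ne_zero n ht)
    ((hcomp x).symm.trans (by rw [hx]; simp [smul_eq_C_mul] : _ = C χ * dehom b x.1))
  refine ⟨(monoBasis b n).repr x 0, ?_⟩
  conv_lhs => rw [← (monoBasis b n).sum_repr x]
  rw [Fintype.sum_eq_single 0, monoBasis_apply]
  intro k hk
  rw [← coeff_dehom, coeff_eq_zero_of_natDegree_lt, zero_smul]
  rw [hdeg]
  exact Nat.pos_of_ne_zero fun h => hk (Fin.ext h)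

end Monomials

/-! ### Three thin families of frames -/

section Families

variable {K : Type*} [Field K] {V : Type*} [AddCommGroup V] [Module K V]

/-- The pair of forms of degree `n` in the vectors `v 0`, `v 1` with coefficients `c 0` and `c 1`. -/
def pairForm (v : Fin 2 → V) (n : ℕ) (c : Fin 2 → Fin (n + 1) → K) : SymPow K V n × SymPow K V n :=
  (∑ k, c 0 k • mono v n k, ∑ k, c 1 k • mono v n k)

/-- The two rows of coefficients of a pair of forms in the monomials of a basis. -/
def coeffs (b : Basis (Fin 2) K V) (n : ℕ) (w : SymPow K V n × SymPow K V n) :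
    Fin 2 → Fin (n + 1) → K :=
  ![(monoBasis b n).repr w.1, (monoBasis b n).repr w.2]

lemma pairForm_coeffs (b : Basis (Fin 2) K V) (n : ℕ) (w : SymPow K V n × SymPow K V n) :
    pairForm b n (coeffs b n w) = w := by
  have h := (monoBasis b n).sum_repr
  simp only [monoBasis_apply] at h
  simp [pairForm, coeffs, h]

lemma coeffs_smul (b : Basis (Fin 2) K V) (n : ℕ) (a : K) (w : SymPow K V n × SymPow K V n)
    (i : Fin 2) (k : Fin (n + 1)) : coeffs b n (a • w) i k = a * coeffs b n w i k := by
  fin_cases i <;> simp [coeffs]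

lemma coeffs_add (b : Basis (Fin 2) K V) (n : ℕ) (w w' : SymPow K V n × SymPow K V n)
    (i : Fin 2) (k : Fin (n + 1)) :
    coeffs b n (w + w') i k = coeffs b n w i k + coeffs b n w' i k := by
  fin_cases i <;> simp [coeffs]

lemma coeffs_prod_symRep_of_diagonal (b : Basis (Fin 2) K V) (n : ℕ)
    {g : LinearMap.GeneralLinearGroup K V} {t : Fin 2 → K}
    (hg : ∀ i, (g : V →ₗ[K] V) (b i) = t i • b i) (w : SymPow K V n × SymPow K V n)
    (i : Fin 2) (k : Fin (n + 1)) :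
    coeffs b n (((symRep n).prod (symRep n)) g w) i k =
      t 0 ^ (n - k : ℕ) * t 1 ^ (k : ℕ) * coeffs b n w i k := by
  have h := repr_symRep_of_diagonal b n hg
  fin_cases i
  · exact h w.1 k
  · exact h w.2 k

variable (K V) in
/-- The inclusion of `S^n V ⊕ S^n V` into `S V ⊕ S V`, where `S V` is the symmetric algebra. -/
def pairIncl (n : ℕ) :
    (SymPow K V n × SymPow K V n) →ₗ[K] (SymmetricAlgebra K V × SymmetricAlgebra K V) :=
  (Submodule.subtype _).prodMap (Submodule.subtype _)

variable (K V) in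
/-- The inclusion of pairs of vectors of `S^n V ⊕ S^n V` into pairs of vectors of `S V ⊕ S V`. -/
def frameIncl (n : ℕ) : (Fin 2 → SymPow K V n × SymPow K V n) →ₗ[K]
    (Fin 2 → SymmetricAlgebra K V × SymmetricAlgebra K V) :=
  (pairIncl K V n).compLeft (Fin 2)

lemma frameIncl_apply (n : ℕ) (u : Fin 2 → SymPow K V n × SymPow K V n) (i : Fin 2) :
    frameIncl K V n u i = pairIncl K V n (u i) := rfl

lemma frameIncl_injective (n : ℕ) : Function.Injective (frameIncl K V n) := by
  intro u u' h
  ext i : 1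
  have h1 : ((u i).1.1, (u i).2.1) = ((u' i).1.1, (u' i).2.1) := congrFun h i
  rw [Prod.mk.injEq] at h1
  exact Prod.ext (Subtype.ext h1.1) (Subtype.ext h1.2)

lemma polyMaps_pairForm {σ : Type*} (n : ℕ) {v : (σ → K) → Fin 2 → V}
    {c : (σ → K) → Fin 2 → Fin (n + 1) → K} (hv : ∀ i, (fun x => v x i) ∈ polyMaps K σ V)
    (hc : ∀ i k, (fun x => c x i k) ∈ polyMaps K σ K) :
    (fun x => pairIncl K V n (pairForm (v x) n (c x))) ∈
      polyMaps K σ (SymmetricAlgebra K V × SymmetricAlgebra K V) := by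
  have hmono : ∀ i k, (fun x => c x i k • (mono (K := K) (v x) n k).1) ∈
      polyMaps K σ (SymmetricAlgebra K V) := fun i k =>
    polyMaps_smul (hc i k) (polyMaps_mul
      (polyMaps_pow (polyMaps_linear (SymmetricAlgebra.ι K V) (hv 0)) _)
      (polyMaps_pow (polyMaps_linear (SymmetricAlgebra.ι K V) (hv 1)) _))
  simp only [pairForm, pairIncl, LinearMap.prodMap_apply, map_sum, map_smul]
  exact polyMaps_prodMk (polyMaps_sum _ (hmono 0)) (polyMaps_sum _ (hmono 1))

/-- The pair of vectors `e (ε i) + p i • e (1 - ε i)`, for a basis `e` of a plane. Up to scaling the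
two vectors, every pair has this form, so only the two parameters `p` matter. -/
def normPair (e : Basis (Fin 2) K V) (ε : Fin 2 → Fin 2) (p : Fin 2 → K) (i : Fin 2) : V :=
  e (ε i) + p i • e (ε i).rev

lemma polyMaps_normPair {σ : Type*} (e : Basis (Fin 2) K V) (ε : Fin 2 → Fin 2)
    {p : (σ → K) → Fin 2 → K} (hp : ∀ i, (fun x => p x i) ∈ polyMaps K σ K) (i : Fin 2) :
    (fun x => normPair e ε (p x) i) ∈ polyMaps K σ V :=
  polyMaps_add (polyMaps_const _) (polyMaps_smul (hp i) (polyMaps_const _))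

lemma polyMaps_dite {σ : Type*} {P : Prop} [Decidable P] (i : P → σ) :
    (fun x : σ → K => if h : P then x (i h) else 0) ∈ polyMaps K σ K := by
  by_cases h : P
  · simpa [h] using polyMaps_coord (i h)
  · simpa [h] using polyMaps_const (K := K) (σ := σ) (0 : K)

lemma finrank_frames (e : Basis (Fin 2) K V) (n : ℕ) :
    finrank K (Fin 2 → SymPow K V n × SymPow K V n) = 4 * (n + 1) := by
  have : FiniteDimensional K (SymPow K V n) := (monoBasis e n).finiteDimensional_of_finite
  rw [finrank_pi_fintype]
  simp [finrank_prod, finrank_symPow e n]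
  ring

/-- Pairs of vectors of `S^n V ⊕ S^n V` that are combinations of the monomials of index in `S` in the
two vectors of some `normPair`. The latter need not be linearly independent. -/
def supportedFrames (e : Basis (Fin 2) K V) (n : ℕ) (ε : Fin 2 → Fin 2) (S : Finset (Fin (n + 1))) :
    Set (Fin 2 → SymPow K V n × SymPow K V n) :=
  {u | ∃ (p : Fin 2 → K) (c : Fin 2 → Fin 2 → Fin (n + 1) → K),
    (∀ i j k, k ∉ S → c i j k = 0) ∧ ∀ i, u i = pairForm (normPair e ε p) n (c i)}

lemma isThin_supportedFrames [Infinite K] (e : Basis (Fin 2) K V) {n : ℕ} (hn : 2 ≤ n)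
    (ε : Fin 2 → Fin 2) {S : Finset (Fin (n + 1))} (hS : 2 * S.card ≤ n + 2) :
    IsThin K (supportedFrames e n ε S) := by
  have : FiniteDimensional K (SymPow K V n) := (monoBasis e n).finiteDimensional_of_finite
  let σ := Fin 2 ⊕ (Fin 2 × Fin 2 × S)
  have hc : ∀ i j k, (fun x : σ → K => if h : k ∈ S then x (Sum.inr (i, j, ⟨k, h⟩)) else 0) ∈
      polyMaps K σ K := fun i j k =>
    polyMaps_dite (σ := σ) fun h : k ∈ S => Sum.inr (i, j, ⟨k, h⟩)
  have hv : ∀ i, (fun x : σ → K => normPair e ε (fun i => x (Sum.inl i)) i) ∈ polyMaps K σ V :=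
    polyMaps_normPair e ε fun i => polyMaps_coord _
  refine IsThin.of_polyMaps (σ := σ) ?_ (frameIncl_injective n)
    (polyMaps_pi fun i => polyMaps_pairForm n hv (hc i)) ?_
  · rw [finrank_frames e]
    simp [σ]
    omega
  · rintro u ⟨p, c, hc, hu⟩
    refine ⟨Sum.elim p fun x => c x.1 x.2.1 x.2.2, ?_⟩
    ext1 i
    rw [frameIncl_apply, hu]
    have : c i = fun j k => if h : k ∈ S then c i j k else 0 := by
      ext j k
      by_cases h : k ∈ S
      · simp [h]
      · simp [h, hc]
    conv_lhs => rw [this]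
    simp only [Sum.elim_inl, Sum.elim_inr]

/-- Pairs of vectors of `S^n V ⊕ S^n V` that lie in the span of two vectors, of which the `m`-th one
is a combination of the monomials of index in `S m` in the two vectors of some `normPair`. The column
`m` of the coefficient matrix has entry `1` in row `a m` and `r m` in the other row. -/
def splitFrames (e : Basis (Fin 2) K V) (n : ℕ) (ε a : Fin 2 → Fin 2)
    (S : Fin 2 → Finset (Fin (n + 1))) : Set (Fin 2 → SymPow K V n × SymPow K V n) :=
  {u | ∃ (p r : Fin 2 → K) (c : Fin 2 → Fin 2 → Fin (n + 1) → K),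
    (∀ m j k, k ∉ S m → c m j k = 0) ∧
    ∀ i, u i = ∑ m, (if i = a m then 1 else r m) • pairForm (normPair e ε p) n (c m)}

lemma isThin_splitFrames [Infinite K] (e : Basis (Fin 2) K V) {n : ℕ} (hn : 2 ≤ n)
    (ε a : Fin 2 → Fin 2) {S : Fin 2 → Finset (Fin (n + 1))}
    (hS : (S 0).card + (S 1).card ≤ n + 1) : IsThin K (splitFrames e n ε a S) := by
  have : FiniteDimensional K (SymPow K V n) := (monoBasis e n).finiteDimensional_of_finite
  let σ := (Fin 2 ⊕ Fin 2) ⊕ (Fin 2 × Σ m, S m)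
  have hcoef : ∀ i m, (fun x : σ → K => if i = a m then 1 else x (Sum.inl (Sum.inr m))) ∈
      polyMaps K σ K := by
    intro i m
    by_cases h : i = a m
    · simpa [h] using polyMaps_const (K := K) (σ := σ) (1 : K)
    · simpa [h] using polyMaps_coord (K := K) _
  have hc : ∀ m j k, (fun x : σ → K => if h : k ∈ S m then x (Sum.inr (j, ⟨m, k, h⟩)) else 0) ∈
      polyMaps K σ K := fun m j k =>
    polyMaps_dite (σ := σ) fun h : k ∈ S m => Sum.inr (j, ⟨m, k, h⟩)
  have hv : ∀ i, (fun x : σ → K => normPair e ε (fun i => x (Sum.inl (Sum.inl i))) i) ∈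
      polyMaps K σ V := polyMaps_normPair e ε fun i => polyMaps_coord _
  refine IsThin.of_polyMaps (σ := σ) ?_ (frameIncl_injective n)
    (polyMaps_pi fun i => polyMaps_sum Finset.univ fun m =>
      polyMaps_smul (hcoef i m) (polyMaps_pairForm n hv (hc m))) ?_
  · rw [finrank_frames e]
    simp [σ, Fin.sum_univ_two]
    omega
  · rintro u ⟨p, r, c, hc, hu⟩
    refine ⟨Sum.elim (Sum.elim p r) fun x => c x.2.1 x.1 x.2.2, ?_⟩
    ext1 i
    have : ∀ m, c m = fun j k => if h : k ∈ S m then c m j k else 0 := by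
      intro m
      ext j k
      by_cases h : k ∈ S m
      · simp [h]
      · simp [h, hc]
    rw [frameIncl_apply, hu, map_sum]
    refine Finset.sum_congr rfl fun m _ => ?_
    rw [map_smul]
    conv_lhs => rw [this m]
    simp only [Sum.elim_inl, Sum.elim_inr]

/-- Pairs of vectors of `S^n V ⊕ S^n V` such that `u i` is congruent to `(α v ^ n, β v ^ n)` modulo
the other vector of the pair, for some vector `v` of `V`. The monomial of index `0` is the `n`-th power
of the first vector, so both vectors of the `normPair` are taken to be `v`. -/
def powerFrames (e : Basis (Fin 2) K V) (n : ℕ) (ε i : Fin 2) :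
    Set (Fin 2 → SymPow K V n × SymPow K V n) :=
  {u | ∃ q s α β : K, u i = (α • mono (normPair e (fun _ => ε) fun _ => q) n 0,
    β • mono (normPair e (fun _ => ε) fun _ => q) n 0) + s • u i.rev}

lemma isThin_powerFrames [Infinite K] (e : Basis (Fin 2) K V) {n : ℕ} (hn : 2 ≤ n)
    (ε i : Fin 2) : IsThin K (powerFrames e n ε i) := by
  have : FiniteDimensional K (SymPow K V n) := (monoBasis e n).finiteDimensional_of_finite
  let σ := Fin 4 ⊕ (Fin 2 × Fin (n + 1))
  have hother := polyMaps_pairForm (K := K) (σ := σ) n (v := fun _ => e)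
    (c := fun x j k => x (Sum.inr (j, k))) (fun i => polyMaps_const _) fun j k => polyMaps_coord _
  have hpow := polyMaps_pow (polyMaps_linear (SymmetricAlgebra.ι K V)
    (polyMaps_normPair (σ := σ) e (fun _ => ε) (p := fun x _ => x (Sum.inl 0))
      (fun _ => polyMaps_coord _) 0)) n
  have hmain := polyMaps_add (polyMaps_prodMk
    (polyMaps_smul (polyMaps_coord (Sum.inl 2)) hpow)
    (polyMaps_smul (polyMaps_coord (Sum.inl 3)) hpow))
    (polyMaps_smul (polyMaps_coord (Sum.inl 1)) hother)
  refine IsThin.of_polyMaps (σ := σ) ?_ (frameIncl_injective n)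
    (polyMaps_add (polyMaps_linear (LinearMap.single K (fun _ => SymmetricAlgebra K V × SymmetricAlgebra K V) i) hmain)
      (polyMaps_linear (LinearMap.single K (fun _ => SymmetricAlgebra K V × SymmetricAlgebra K V) i.rev) hother)) ?_
  · rw [finrank_frames e]
    simp [σ]
    omega
  · rintro u ⟨q, s, α, β, hu⟩
    refine ⟨Sum.elim ![q, s, α, β] fun x => coeffs e n (u i.rev) x.1 x.2, ?_⟩
    have hi : i ≠ i.rev := by
      fin_cases i <;> decide
    have hui : pairIncl K V n (u i) = (α • SymmetricAlgebra.ι K V (e ε + q • e ε.rev) ^ n,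
        β • SymmetricAlgebra.ι K V (e ε + q • e ε.rev) ^ n) + s • pairIncl K V n (u i.rev) := by
      rw [hu, map_add, map_smul]
      simp [pairIncl, mono, normPair]
    have hur := pairForm_coeffs e n (u i.rev)
    have hsplit : frameIncl K V n u = LinearMap.single K (fun _ => SymmetricAlgebra K V × SymmetricAlgebra K V) i (pairIncl K V n (u i)) +
        LinearMap.single K (fun _ => SymmetricAlgebra K V × SymmetricAlgebra K V) i.rev (pairIncl K V n (u i.rev)) := by
      ext1 j
      rw [frameIncl_apply]
      rcases (by fin_cases i <;> fin_cases j <;> decide : j = i ∨ j = i.rev) with rfl | rfl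
      · simp [hi]
      · simp [hi.symm]
    rw [hsplit, hui]
    nth_rw 1 2 [← hur]
    rfl

end Families

/-! ### Frames of planes with nontrivial stabiliser -/

section Cover

variable {K : Type*} [Field K] {V : Type*} [AddCommGroup V] [Module K V]

lemma mem_powerFrames (e b : Basis (Fin 2) K V) (n : ℕ) {u : Fin 2 → SymPow K V n × SymPow K V n}
    {r : Fin 2 → K} (hr : r ≠ 0) {α β : K}
    (hu : ∑ i, r i • u i = (α • mono b n 0, β • mono b n 0)) :
    ∃ ε i, u ∈ powerFrames e n ε i := by
  obtain ⟨i, hi⟩ := Function.ne_iff.mp hr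
  obtain ⟨ε, q, c, hc⟩ := exists_smul_add_rev e (b 0)
  have hmono : mono (K := K) b n 0 =
      c ^ n • mono (normPair e (fun _ => ε) fun _ => q) n 0 := by
    apply Subtype.ext
    simp [mono, hc, normPair]
    rw [← smul_add, smul_pow]
  refine ⟨ε, i, q, -((r i)⁻¹ * r i.rev), (r i)⁻¹ * α * c ^ n, (r i)⁻¹ * β * c ^ n, ?_⟩
  have hsum : r i • u i + r i.rev • u i.rev = (α • mono b n 0, β • mono b n 0) := by
    rw [← hu, Fin.sum_univ_two]
    fin_cases i
    · rfl
    · exact add_comm _ _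
  have hui : u i = (r i)⁻¹ • (α • mono (K := K) b n 0, β • mono (K := K) b n 0) +
      (-((r i)⁻¹ * r i.rev)) • u i.rev := by
    rw [← hsum, smul_add, smul_smul, smul_smul, inv_mul_cancel₀ hi]
    module
  rw [hui, hmono]
  simp [smul_smul, mul_assoc]

/-- A fibre of the weights `k ↦ t₀ ^ (n - k) t₁ ^ k` contains no two consecutive indices if
`t₀ ≠ t₁`, hence at most about half of them. -/
lemma two_mul_card_weights_le {n : ℕ} {t : Fin 2 → K} (ht0 : ∀ i, t i ≠ 0) (ht : t 0 ≠ t 1) {χ : K}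
    {S : Finset (Fin (n + 1))} (hS : ∀ k ∈ S, t 0 ^ (n - k : ℕ) * t 1 ^ (k : ℕ) = χ) :
    2 * S.card ≤ n + 2 := by
  have hdisj : Disjoint (S.map Fin.castSuccEmb) (S.map (Fin.succEmb (n + 1))) := by
    rw [Finset.disjoint_left]
    intro x hx hx'
    obtain ⟨k, hk, rfl⟩ := Finset.mem_map.mp hx
    obtain ⟨l, hl, hlk⟩ := Finset.mem_map.mp hx'
    have hval : (l : ℕ) + 1 = k := by simpa using congrArg Fin.val hlk
    have h := (hS k hk).trans (hS l hl).symm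
    have hn : n - (l : ℕ) = n - k + 1 := by omega
    rw [hn, ← hval, pow_succ, pow_succ, mul_comm (t 1 ^ (l : ℕ)), mul_assoc (t 0 ^ _),
      ← mul_assoc, ← mul_assoc] at h
    have h1 := mul_right_cancel₀ (pow_ne_zero _ (ht0 1)) h
    exact ht (mul_left_cancel₀ (pow_ne_zero _ (ht0 0)) h1).symm
  have hcard := Finset.card_le_univ (S.map Fin.castSuccEmb ∪ S.map (Fin.succEmb (n + 1)))
  rw [Finset.card_union_of_disjoint hdisj, Finset.card_map, Finset.card_map, Fintype.card_fin]
    at hcard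
  omega

/-- An eigenvector of a diagonal `g` only involves the monomials whose weight is the eigenvalue. -/
lemma coeffs_eq_zero_of_eigenvector (b : Basis (Fin 2) K V) (n : ℕ)
    {g : LinearMap.GeneralLinearGroup K V} {t : Fin 2 → K}
    (hg : ∀ i, (g : V →ₗ[K] V) (b i) = t i • b i) {w : SymPow K V n × SymPow K V n} {χ : K}
    (hw : ((symRep n).prod (symRep n)) g w = χ • w) (i : Fin 2) (k : Fin (n + 1))
    (hk : t 0 ^ (n - k : ℕ) * t 1 ^ (k : ℕ) ≠ χ) : coeffs b n w i k = 0 := by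
  have h := coeffs_prod_symRep_of_diagonal b n hg w i k
  rw [hw, coeffs_smul, ← sub_eq_zero, ← sub_mul] at h
  exact (mul_eq_zero.mp h).resolve_left (sub_ne_zero.mpr hk.symm)

/-- A frame of a plane that a nonscalar `g` maps to itself belongs to one of the three families. -/
lemma mem_families [IsAlgClosed K] [CharZero K] (e : Basis (Fin 2) K V) (n : ℕ)
    {g : LinearMap.GeneralLinearGroup K V} (hg : g ∉ scalarSubgroup K V)
    {u : Fin 2 → SymPow K V n × SymPow K V n} (hu : LinearIndependent K u)
    (hgu : (Submodule.span K (Set.range u)).map (((symRep n).prod (symRep n)) g) ≤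
      Submodule.span K (Set.range u)) :
    (∃ ε S, 2 * S.card ≤ n + 2 ∧ u ∈ supportedFrames e n ε S) ∨
    (∃ ε a S, (S 0).card + (S 1).card ≤ n + 1 ∧ u ∈ splitFrames e n ε a S) ∨
    (∃ ε i, u ∈ powerFrames e n ε i) := by
  classical
  set ρ := ((symRep (K := K) (V := V) n).prod (symRep n)) g with hρ
  set U := Submodule.span K (Set.range u) with hU
  have hUmem : ∀ i, u i ∈ U := fun i => Submodule.subset_span ⟨i, rfl⟩
  let T : U →ₗ[K] U := ρ.restrict fun x hx => hgu (Submodule.mem_map_of_mem hx)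
  have hTcoe : ∀ x, (T x : SymPow K V n × SymPow K V n) = ρ x := fun x => rfl
  have hfinU : finrank K U = 2 := by simpa using finrank_span_eq_card hu
  have hfinV : finrank K V = 2 := by simpa using finrank_eq_card_basis e
  have hginj : ∀ v : V, (g : V →ₗ[K] V) v = 0 → v = 0 := fun v hv => by
    have h : (↑g⁻¹ : V →ₗ[K] V) ((g : V →ₗ[K] V) v) = v :=
      congrArg (fun f : V →ₗ[K] V => f v) g.inv_mul
    rw [← h, hv, map_zero]
  rcases end_trichotomy hfinV (g : V →ₗ[K] V) with ⟨t, ht⟩ | ⟨b, t, ht, hb⟩ | ⟨b, t, s, hs, hb0, hb1⟩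
  · refine absurd ?_ hg
    have ht0 : t ≠ 0 := by
      rintro rfl
      exact e.ne_zero 0 (hginj _ (by simp [ht]))
    refine ⟨Units.mk0 t ht0, Units.ext (LinearMap.ext fun v => ?_)⟩
    simp [ht]
  · -- After rescaling, the eigenvectors of `g` form a `normPair`.
    choose ε p c hc using fun i => exists_smul_add_rev e (b i)
    have hc0 : ∀ i, c i ≠ 0 := fun i h => b.ne_zero i (by rw [hc, h, zero_smul])
    let b' := b.isUnitSMul fun i => (inv_ne_zero (hc0 i)).isUnit
    have hb'n : ⇑b' = normPair e ε p := by
      ext1 i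
      rw [Basis.isUnitSMul_apply, hc, smul_smul, inv_mul_cancel₀ (hc0 i), one_smul]
      rfl
    have hb' : ∀ i, (g : V →ₗ[K] V) (b' i) = t i • b' i := fun i => by
      rw [Basis.isUnitSMul_apply, map_smul, hb, smul_comm]
    have ht0 : ∀ i, t i ≠ 0 := fun i h => b.ne_zero i (hginj _ (by rw [hb, h, zero_smul]))
    let wt (χ : K) : Finset (Fin (n + 1)) :=
      Finset.univ.filter fun k => t 0 ^ (n - k : ℕ) * t 1 ^ (k : ℕ) = χ
    have hsupp : ∀ {w : SymPow K V n × SymPow K V n} {χ : K}, ρ w = χ • w →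
        ∀ j k, k ∉ wt χ → coeffs b' n w j k = 0 := fun hw j k hk =>
      coeffs_eq_zero_of_eigenvector b' n hb' hw j k (by simpa [wt] using hk)
    rcases end_trichotomy (K := K) (W := U) hfinU T with ⟨χ, hχ⟩ | ⟨w, χ, hχ, hw⟩ | ⟨w, χ, s, hs, hw0, hw1⟩
    · refine Or.inl ⟨ε, wt χ, two_mul_card_weights_le ht0 ht fun k hk => by simpa [wt] using hk,
        p, fun i => coeffs b' n (u i), fun i => hsupp ?_, fun i => ?_⟩
      · exact congrArg Subtype.val (hχ ⟨u i, hUmem i⟩)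
      · rw [← hb'n, pairForm_coeffs]
    · choose a r d hd using fun m =>
        exists_smul_add_rev (Pi.basisFun K (Fin 2)) fun i => w.repr ⟨u i, hUmem i⟩ m
      have hd' : ∀ i m, w.repr ⟨u i, hUmem i⟩ m = (if i = a m then 1 else r m) * d m := by
        intro i m
        rw [show w.repr ⟨u i, hUmem i⟩ m = _ from congrFun (hd m) i]
        generalize a m = a'
        fin_cases i <;> fin_cases a' <;> simp [Fin.rev, mul_comm]
      refine Or.inr (Or.inl ⟨ε, a, fun m => wt (χ m), ?_, p, r,
        fun m => coeffs b' n (d m • (w m : SymPow K V n × SymPow K V n)), fun m => hsupp ?_,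
        fun i => ?_⟩)
      · have hdisj : Disjoint (wt (χ 0)) (wt (χ 1)) := by
          rw [Finset.disjoint_left]
          intro k hk hk'
          simp only [wt, Finset.mem_filter, Finset.mem_univ, true_and] at hk hk'
          exact hχ (hk.symm.trans hk')
        rw [← Finset.card_union_of_disjoint hdisj]
        simpa using Finset.card_le_univ (wt (χ 0) ∪ wt (χ 1))
      · rw [map_smul, ← hTcoe, hw, Submodule.coe_smul, smul_comm]
      · have h := congrArg Subtype.val (w.sum_repr ⟨u i, hUmem i⟩)
        simp only [← hb'n, pairForm_coeffs]
        rw [AddSubmonoidClass.coe_finsetSum] at h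
        refine h.symm.trans (Finset.sum_congr rfl fun m _ => ?_)
        rw [Submodule.coe_smul, hd', mul_smul]
    · -- A Jordan block cannot occur in `U`, since `g` acts diagonalisably on `S^n V ⊕ S^n V`.
      exfalso
      have hw0' : ρ (w 0) = χ • (w 0 : SymPow K V n × SymPow K V n) := congrArg Subtype.val hw0
      have hw1' : ρ (w 1) = χ • (w 1 : SymPow K V n × SymPow K V n) + s • (w 0 : _ × _) :=
        congrArg Subtype.val hw1
      have hzero : ∀ j k, coeffs b' n (w 0) j k = 0 := by
        intro j k
        by_cases hk : t 0 ^ (n - k : ℕ) * t 1 ^ (k : ℕ) = χ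
        · have h := coeffs_prod_symRep_of_diagonal b' n hb' (w 1) j k
          rw [← hρ, hw1', coeffs_add, coeffs_smul, coeffs_smul, hk, add_eq_left] at h
          exact (mul_eq_zero.mp h).resolve_left hs
        · exact coeffs_eq_zero_of_eigenvector b' n hb' hw0' j k hk
      refine w.ne_zero 0 (Subtype.ext ?_)
      rw [← pairForm_coeffs b' n (w 0)]
      simp [pairForm, hzero]
  · -- Any eigenvector of `g` in `U` is a pair of multiples of `(b 0) ^ n`.
    have ht0 : t ≠ 0 := fun h => b.ne_zero 0 (hginj _ (by rw [hb0, h, zero_smul]))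
    have : FiniteDimensional K U := FiniteDimensional.of_finrank_pos (by omega)
    have : Nontrivial U := nontrivial_of_finrank_pos (R := K) (by omega)
    obtain ⟨χ, hχ⟩ := Module.End.exists_eigenvalue (K := K) (V := U) T
    obtain ⟨w, hw⟩ := hχ.exists_hasEigenvector
    have hρw : ρ w = χ • (w : SymPow K V n × SymPow K V n) := congrArg Subtype.val hw.apply_eq_smul
    obtain ⟨α, hα⟩ := eigenvector_of_jordan b n ht0 hs hb0 hb1 (congrArg Prod.fst hρw)
    obtain ⟨β, hβ⟩ := eigenvector_of_jordan b n ht0 hs hb0 hb1 (congrArg Prod.snd hρw)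
    obtain ⟨r, hr⟩ := (Submodule.mem_span_range_iff_exists_fun K).mp w.2
    refine Or.inr (Or.inr (mem_powerFrames e b n (r := r) ?_ (hr.trans (Prod.ext hα hβ))))
    rintro rfl
    exact hw.2 (Subtype.ext (by simpa using hr.symm))

end Cover

lemma isAlmostFree_pgl {K : Type*} [Field K] [IsAlgClosed K] [CharZero K] {V : Type*}
    [AddCommGroup V] [Module K V] (hV : finrank K V = 2) {n : ℕ} (hn : 2 ≤ n) :
    IsAlmostFree (PGL K V) (Grass K 2 (SymPow K V n × SymPow K V n)) := by
  have : FiniteDimensional K V := FiniteDimensional.of_finrank_pos (by omega)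
  let e := finBasisOfFinrankEq K V hV
  have : FiniteDimensional K (SymPow K V n) := (monoBasis e n).finiteDimensional_of_finite
  apply isAlmostFree_of_isThin
  have hA : IsThin K (⋃ x : (Fin 2 → Fin 2) × {S : Finset (Fin (n + 1)) // 2 * S.card ≤ n + 2},
      supportedFrames e n x.1 x.2.1) :=
    IsThin.iUnion fun x => isThin_supportedFrames e hn x.1 x.2.2
  have hB : IsThin K (⋃ x : (Fin 2 → Fin 2) × (Fin 2 → Fin 2) ×
      {S : Fin 2 → Finset (Fin (n + 1)) // (S 0).card + (S 1).card ≤ n + 1},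
      splitFrames e n x.1 x.2.1 x.2.2.1) :=
    IsThin.iUnion fun x => isThin_splitFrames e hn x.1 x.2.1 x.2.2.2
  have hC : IsThin K (⋃ x : Fin 2 × Fin 2, powerFrames e n x.1 x.2) :=
    IsThin.iUnion fun x => isThin_powerFrames e hn x.1 x.2
  refine (hA.union (hB.union hC)).mono fun u hu => ?_
  suffices h : (∃ ε S, 2 * S.card ≤ n + 2 ∧ u ∈ supportedFrames e n ε S) ∨
      (∃ ε a S, (S 0).card + (S 1).card ≤ n + 1 ∧ u ∈ splitFrames e n ε a S) ∨
      (∃ ε i, u ∈ powerFrames e n ε i) by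
    simp only [Set.mem_union, Set.mem_iUnion]
    rcases h with ⟨ε, S, hS, h⟩ | ⟨ε, a, S, hS, h⟩ | ⟨ε, i, h⟩
    · exact Or.inl ⟨(ε, ⟨S, hS⟩), h⟩
    · exact Or.inr (Or.inl ⟨(ε, a, ⟨S, hS⟩), h⟩)
    · exact Or.inr (Or.inr ⟨(ε, i), h⟩)
  by_cases hind : LinearIndependent K u
  · obtain ⟨⟨x, hx⟩, hx1⟩ := (Subgroup.ne_bot_iff_exists_ne_one).mp (hu hind)
    obtain ⟨g, rfl⟩ := QuotientGroup.mk_surjective x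
    refine mem_families e n (g := g) (fun hg => hx1 ?_) hind ?_
    · exact Subtype.ext ((QuotientGroup.eq_one_iff g).mpr hg)
    · exact (congrArg Grass.toSubmodule (MulAction.mem_stabilizer_iff.mp hx)).le
  · -- Linearly dependent pairs lie in the third family, with `α = β = 0`.
    rw [Fintype.linearIndependent_iff] at hind
    push Not at hind
    obtain ⟨r, hr, i, hi⟩ := hind
    exact Or.inr (Or.inr (mem_powerFrames e e n (r := r) (α := 0) (β := 0)
      (fun h => hi (congrFun h i)) (by simpa [← Prod.zero_eq_mk] using hr)))

end InstantonGrass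

end


theorem lemma4p2 (V : Type*) [AddCommGroup V] [Module ℂ V] (hV : Module.finrank ℂ V = 2)
    (n : ℕ) (hn : 2 ≤ n) :
    InstantonGrass.IsAlmostFree (InstantonGrass.PGL ℂ V)
      (InstantonGrass.Grass ℂ 2 (InstantonGrass.SymPow ℂ V n × InstantonGrass.SymPow ℂ V n)) :=
  InstantonGrass.isAlmostFree_pgl hV hn
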